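/- **Setting.** An *order-type* over $n\in\mathbb N$ is a tuple $\varepsilon\in\{1,\partial\}^n$; let $1^\partial=\partial$ and $\partial^\partial=1$. An *LE-signature* consists of two disjoint sets $\mathcal F,\mathcal G$ of connectives, each $h\in\mathcal F\cup\mathcal G$ having an arity $n_h\in\mathbb N$ and an order-type $\varepsilon_h$ over $n_h$. Fix a denumerable set $\mathsf{AtProp}$ of proposition letters. The formulas of $\mathcal L_{\mathrm{LE}}(\mathcal F,\mathcal G)$ are $$\varphi::=p\mid\bot\mid\top\mid\varphi\wedge\varphi\mid\varphi\vee\varphi\mid f(\varphi_1,\dots,\varphi_{n_f})\mid g(\varphi_1,\dots,\varphi_{n_g})\qquad(p\in\mathsf{AtProp},\ f\in\mathcal F,\ g\in\mathcal G).$$ A sequent is a pair $\varphi\vdash\psi$ of formulas. For a connective $h$ and a coordinate $i$ write $h[\varphi]_i$ for $h(p_1,\dots,\varphi,\dots,p_{n_h})$ with $\varphi$ in the $i$-th place and proposition letters elsewhere (the same ones throughout an axiom or rule). **The basic LE-logic** $\mathbb L_{\mathrm{LE}}(\mathcal F,\mathcal G)$ is the least set of sequents that contains, for all letters $p,q$ (and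 all letters in the other places), the axioms * $p\vdash p$, $\ \bot\vdash p$, $\ p\vdash\top$, $\ p\vdash p\vee q$, $\ q\vdash p\vee q$, $\ p\wedge q\vdash p$, $\ p\wedge q\vdash q$; * $f[\bot]_i\vdash\bot$ and $f[p\vee q]_i\vdash f[p]_i\vee f[q]_i$ if $\varepsilon_f(i)=1$; $\ f[\top]_i\vdash\bot$ and $f[p\wedge q]_i\vdash f[p]_i\vee f[q]_i$ if $\varepsilon_f(i)=\partial$; * $\top\vdash g[\top]_i$ and $g[p]_i\wedge g[q]_i\vdash g[p\wedge q]_i$ if $\varepsilon_g(i)=1$; $\ \top\vdash g[\bot]_i$ and $g[p]_i\wedge g[q]_i\vdash g[p\vee q]_i$ if $\varepsilon_g(i)=\partial$; and is closed under the following rules: * from $\varphi\vdash\chi$ and $\chi\vdash\psi$ infer $\varphi\vdash\psi$; * from $\varphi\vdash\psi$ infer $\varphi(\chi/p)\vdash\psi(\chi/p)$, for every formula $\chi$ and letter $p$; * from $\chi\vdash\varphi$ and $\chi\vdash\psi$ infer $\chi\vdash\varphi\wedge\psi$; from $\varphi\vdash\chi$ and $\psi\vdash\chi$ infer $\varphi\vee\psi\vdash\chi$;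 * for $h\in\mathcal F\cup\mathcal G$, from $\varphi\vdash\psi$ infer $h[\varphi]_i\vdash h[\psi]_i$ if $\varepsilon_h(i)=1$, and $h[\psi]_i\vdash h[\varphi]_i$ if $\varepsilon_h(i)=\partial$. **The tense language** $\mathcal L^*_{\mathrm{LE}}=\mathcal L_{\mathrm{LE}}(\mathcal F^*,\mathcal G^*)$ is obtained by adding, for each $f\in\mathcal F$ and $1\le i\le n_f$, an $n_f$-ary connective $f^\sharp_i$, and for each $g\in\mathcal G$ and $1\le i\le n_g$, an $n_g$-ary connective $g^\flat_i$. Here $f^\sharp_i\in\mathcal G^*$ if $\varepsilon_f(i)=1$ and $f^\sharp_i\in\mathcal F^*$ if $\varepsilon_f(i)=\partial$; $g^\flat_i\in\mathcal F^*$ if $\varepsilon_g(i)=1$ and $g^\flat_i\in\mathcal G^*$ if $\varepsilon_g(i)=\partial$. If $k$ is the connective so added for $h\in\mathcal F\cup\mathcal G$ and $i$, then $\varepsilon_k(i)=\varepsilon_h(i)$ and, for $j\ne i$, $\varepsilon_k(j)=\varepsilon_h(j)^\partial$ if $\varepsilon_h(i)=1$, and $\varepsilon_k(j)=\varepsilon_h(j)$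 if $\varepsilon_h(i)=\partial$. **The basic tense logic** $\mathbb L^*_{\mathrm{LE}}$ is the least set of $\mathcal L^*_{\mathrm{LE}}$-sequents that contains the above axioms and is closed under the above rules, taken for the signature $(\mathcal F^*,\mathcal G^*)$, and is moreover closed, in both directions, under the following rules, for $f\in\mathcal F$, $g\in\mathcal G$ and arbitrary $\mathcal L^*_{\mathrm{LE}}$-formulas (the $i$-th argument is displayed, the others are the same on both sides): * $f(\varphi_1,\dots,\varphi,\dots,\varphi_{n_f})\vdash\psi$ iff $\varphi\vdash f^\sharp_i(\varphi_1,\dots,\psi,\dots,\varphi_{n_f})$, if $\varepsilon_f(i)=1$; * $f(\varphi_1,\dots,\varphi,\dots,\varphi_{n_f})\vdash\psi$ iff $f^\sharp_i(\varphi_1,\dots,\psi,\dots,\varphi_{n_f})\vdash\varphi$, if $\varepsilon_f(i)=\partial$; * $\varphi\vdash g(\varphi_1,\dots,\psi,\dots,\varphi_{n_g})$ iff $g^\flat_i(\varphi_1,\dots,\varphi,\dots,\varphi_{n_g})\vdash\psi$, if $\varepsilon_g(i)=1$; * $\varphi\vdash g(\varphi_1,\dots,\psi,\dots,\varphi_{n_g})$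 iff $\psi\vdash g^\flat_i(\varphi_1,\dots,\varphi,\dots,\varphi_{n_g})$, if $\varepsilon_g(i)=\partial$. **Theorem.** For every LE-signature $(\mathcal F,\mathcal G)$, the logic $\mathbb L^*_{\mathrm{LE}}$ is a conservative extension of $\mathbb L_{\mathrm{LE}}$: every $\mathcal L_{\mathrm{LE}}$-sequent $\varphi\vdash\psi$ is derivable in $\mathbb L_{\mathrm{LE}}$ if and only if it is derivable in $\mathbb L^*_{\mathrm{LE}}$. -/

import Mathlib

universe u v w

namespace LELogic

/-- The two entries `1` and `∂` of an order-type. -/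
inductive Sgn : Type
  | one : Sgn
  | del : Sgn

/-- The opposite entry: `1` and `∂` are swapped. -/
def Sgn.opp : Sgn → Sgn
  | Sgn.one => Sgn.del
  | Sgn.del => Sgn.one

/-- An order-type over `n`. -/
abbrev OrderType (n : ℕ) : Type := Fin n → Sgn

/-- An LE-signature: two (automatically disjoint) sets of connectives `F` and `G`, each connective
having a finite arity and an order-type over that arity. -/
structure Signature : Type (max (u + 1) (v + 1)) where
  F : Type u
  G : Type v
  arF : F → ℕ
  arG : G → ℕ
  ordF : (f : F) → OrderType (arF f)
  ordG : (g : G) → OrderType (arG g)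

/-- The formulas of the LE-language of signature `S` over the proposition letters `P`. -/
inductive Formula (S : Signature.{u, v}) (P : Type w) : Type (max u v w)
  | var (p : P) : Formula S P
  | bot : Formula S P
  | top : Formula S P
  | and (φ ψ : Formula S P) : Formula S P
  | or (φ ψ : Formula S P) : Formula S P
  | opF (f : S.F) (args : Fin (S.arF f) → Formula S P) : Formula S P
  | opG (g : S.G) (args : Fin (S.arG g) → Formula S P) : Formula S P

/-- Simultaneous substitution of formulas for proposition letters. -/
def Formula.subst {S : Signature.{u, v}} {P : Type w} (σ : P → Formula S P) :
    Formula S P → Formula S P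
  | .var p => σ p
  | .bot => .bot
  | .top => .top
  | .and φ ψ => .and (φ.subst σ) (ψ.subst σ)
  | .or φ ψ => .or (φ.subst σ) (ψ.subst σ)
  | .opF f args => .opF f (fun i => (args i).subst σ)
  | .opG g args => .opG g (fun i => (args i).subst σ)

/-- `φ.subst1 χ p` is `φ(χ/p)`: every occurrence of the letter `p` is replaced by `χ`. -/
def Formula.subst1 {S : Signature.{u, v}} {P : Type w} [DecidableEq P]
    (φ χ : Formula S P) (p : P) : Formula S P :=
  φ.subst (Function.update Formula.var p χ)

/-- `f(p₁, …, φ, …, pₙ)`: the connective `f` applied to proposition letters, except that the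
`i`-th argument is `φ`. -/
def Formula.atF {S : Signature.{u, v}} {P : Type w} (f : S.F) (a : Fin (S.arF f) → P)
    (i : Fin (S.arF f)) (φ : Formula S P) : Formula S P :=
  .opF f (Function.update (fun j => Formula.var (a j)) i φ)

/-- `g(p₁, …, φ, …, pₙ)`: the connective `g` applied to proposition letters, except that the
`i`-th argument is `φ`. -/
def Formula.atG {S : Signature.{u, v}} {P : Type w} (g : S.G) (a : Fin (S.arG g) → P)
    (i : Fin (S.arG g)) (φ : Formula S P) : Formula S P :=
  .opG g (Function.update (fun j => Formula.var (a j)) i φ)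

/-- A sequent `lhs ⊢ rhs`. -/
structure Sequent (S : Signature.{u, v}) (P : Type w) : Type (max u v w) where
  lhs : Formula S P
  rhs : Formula S P

open Formula in
/-- The least set of sequents that contains the axioms of the basic LE-logic of signature `S` and
is closed under its inference rules and under the additional unary rules in `R`, where `R s t`
means that `t` may be inferred from `s`. -/
inductive Derivable (S : Signature.{u, v}) (P : Type w) [DecidableEq P]
    (R : Sequent S P → Sequent S P → Prop) : Sequent S P → Prop
  -- lattice axioms
  | refl (p : P) : Derivable S P R ⟨var p, var p⟩
  | botLe (p : P) : Derivable S P R ⟨bot, var p⟩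
  | leTop (p : P) : Derivable S P R ⟨var p, top⟩
  | leOrLeft (p q : P) : Derivable S P R ⟨var p, or (var p) (var q)⟩
  | leOrRight (p q : P) : Derivable S P R ⟨var q, or (var p) (var q)⟩
  | andLeLeft (p q : P) : Derivable S P R ⟨and (var p) (var q), var p⟩
  | andLeRight (p q : P) : Derivable S P R ⟨and (var p) (var q), var q⟩
  -- axioms for the connectives
  | fBot (f : S.F) (a : Fin (S.arF f) → P) (i : Fin (S.arF f)) (hi : S.ordF f i = Sgn.one) :
      Derivable S P R ⟨atF f a i bot, bot⟩
  | fTop (f : S.F) (a : Fin (S.arF f) → P) (i : Fin (S.arF f)) (hi : S.ordF f i = Sgn.del) :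
      Derivable S P R ⟨atF f a i top, bot⟩
  | gTop (g : S.G) (a : Fin (S.arG g) → P) (i : Fin (S.arG g)) (hi : S.ordG g i = Sgn.one) :
      Derivable S P R ⟨top, atG g a i top⟩
  | gBot (g : S.G) (a : Fin (S.arG g) → P) (i : Fin (S.arG g)) (hi : S.ordG g i = Sgn.del) :
      Derivable S P R ⟨top, atG g a i bot⟩
  | fOr (f : S.F) (a : Fin (S.arF f) → P) (i : Fin (S.arF f)) (p q : P)
      (hi : S.ordF f i = Sgn.one) :
      Derivable S P R
        ⟨atF f a i (or (var p) (var q)), or (atF f a i (var p)) (atF f a i (var q))⟩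
  | fAnd (f : S.F) (a : Fin (S.arF f) → P) (i : Fin (S.arF f)) (p q : P)
      (hi : S.ordF f i = Sgn.del) :
      Derivable S P R
        ⟨atF f a i (and (var p) (var q)), or (atF f a i (var p)) (atF f a i (var q))⟩
  | gAnd (g : S.G) (a : Fin (S.arG g) → P) (i : Fin (S.arG g)) (p q : P)
      (hi : S.ordG g i = Sgn.one) :
      Derivable S P R
        ⟨and (atG g a i (var p)) (atG g a i (var q)), atG g a i (and (var p) (var q))⟩
  | gOr (g : S.G) (a : Fin (S.arG g) → P) (i : Fin (S.arG g)) (p q : P)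
      (hi : S.ordG g i = Sgn.del) :
      Derivable S P R
        ⟨and (atG g a i (var p)) (atG g a i (var q)), atG g a i (or (var p) (var q))⟩
  -- inference rules
  | cut (φ χ ψ : Formula S P) (h₁ : Derivable S P R ⟨φ, χ⟩) (h₂ : Derivable S P R ⟨χ, ψ⟩) :
      Derivable S P R ⟨φ, ψ⟩
  | substitution (φ ψ χ : Formula S P) (p : P) (h : Derivable S P R ⟨φ, ψ⟩) :
      Derivable S P R ⟨φ.subst1 χ p, ψ.subst1 χ p⟩
  | leAnd (χ φ ψ : Formula S P) (h₁ : Derivable S P R ⟨χ, φ⟩) (h₂ : Derivable S P R ⟨χ, ψ⟩) :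
      Derivable S P R ⟨χ, and φ ψ⟩
  | orLe (φ ψ χ : Formula S P) (h₁ : Derivable S P R ⟨φ, χ⟩) (h₂ : Derivable S P R ⟨ψ, χ⟩) :
      Derivable S P R ⟨or φ ψ, χ⟩
  | fMono (f : S.F) (a : Fin (S.arF f) → P) (i : Fin (S.arF f)) (φ ψ : Formula S P)
      (hi : S.ordF f i = Sgn.one) (h : Derivable S P R ⟨φ, ψ⟩) :
      Derivable S P R ⟨atF f a i φ, atF f a i ψ⟩
  | fAnti (f : S.F) (a : Fin (S.arF f) → P) (i : Fin (S.arF f)) (φ ψ : Formula S P)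
      (hi : S.ordF f i = Sgn.del) (h : Derivable S P R ⟨φ, ψ⟩) :
      Derivable S P R ⟨atF f a i ψ, atF f a i φ⟩
  | gMono (g : S.G) (a : Fin (S.arG g) → P) (i : Fin (S.arG g)) (φ ψ : Formula S P)
      (hi : S.ordG g i = Sgn.one) (h : Derivable S P R ⟨φ, ψ⟩) :
      Derivable S P R ⟨atG g a i φ, atG g a i ψ⟩
  | gAnti (g : S.G) (a : Fin (S.arG g) → P) (i : Fin (S.arG g)) (φ ψ : Formula S P)
      (hi : S.ordG g i = Sgn.del) (h : Derivable S P R ⟨φ, ψ⟩) :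
      Derivable S P R ⟨atG g a i ψ, atG g a i φ⟩
  -- additional rules
  | extra (s t : Sequent S P) (hR : R s t) (h : Derivable S P R s) : Derivable S P R t

/-- The basic (minimal) LE-logic of signature `S`. -/
def basicLogic (S : Signature.{u, v}) (P : Type w) [DecidableEq P] : Set (Sequent S P) :=
  {s | Derivable S P (fun _ _ => False) s}

/-- The connectives in `F*`: those of `F`, the Galois-adjoints `f♯ᵢ` of `f ∈ F` in the
coordinates `i` with `ε_f(i) = ∂`, and the left residuals `g♭ᵢ` of `g ∈ G` in the coordinates `i`
with `ε_g(i) = 1`. -/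
inductive FStar (S : Signature.{u, v}) : Type (max u v)
  | base (f : S.F) : FStar S
  | sharp (f : S.F) (i : Fin (S.arF f)) (hi : S.ordF f i = Sgn.del) : FStar S
  | flat (g : S.G) (i : Fin (S.arG g)) (hi : S.ordG g i = Sgn.one) : FStar S

/-- The connectives in `G*`: those of `G`, the right residuals `f♯ᵢ` of `f ∈ F` in the
coordinates `i` with `ε_f(i) = 1`, and the Galois-adjoints `g♭ᵢ` of `g ∈ G` in the coordinates `i`
with `ε_g(i) = ∂`. -/
inductive GStar (S : Signature.{u, v}) : Type (max u v)
  | base (g : S.G) : GStar S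
  | sharp (f : S.F) (i : Fin (S.arF f)) (hi : S.ordF f i = Sgn.one) : GStar S
  | flat (g : S.G) (i : Fin (S.arG g)) (hi : S.ordG g i = Sgn.del) : GStar S

/-- The order-type of the residual in coordinate `i` of a connective of order-type `ε`: it keeps
the entry at `i`, and its other entries are those of the opposite of `ε` if `ε i = 1`, and those of
`ε` itself if `ε i = ∂`. -/
def residualOrd {n : ℕ} (ε : OrderType n) (i : Fin n) : OrderType n := fun j =>
  if j = i then ε i
  else match ε i with
    | Sgn.one => (ε j).opp
    | Sgn.del => ε j

def FStar.arity {S : Signature.{u, v}} : FStar S → ℕ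
  | .base f => S.arF f
  | .sharp f _ _ => S.arF f
  | .flat g _ _ => S.arG g

def GStar.arity {S : Signature.{u, v}} : GStar S → ℕ
  | .base g => S.arG g
  | .sharp f _ _ => S.arF f
  | .flat g _ _ => S.arG g

def FStar.ord {S : Signature.{u, v}} : (k : FStar S) → OrderType k.arity
  | .base f => S.ordF f
  | .sharp f i _ => residualOrd (S.ordF f) i
  | .flat g i _ => residualOrd (S.ordG g) i

def GStar.ord {S : Signature.{u, v}} : (k : GStar S) → OrderType k.arity
  | .base g => S.ordG g
  | .sharp f i _ => residualOrd (S.ordF f) i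
  | .flat g i _ => residualOrd (S.ordG g) i

/-- The signature of the tense language associated with `S`. -/
def Signature.star (S : Signature.{u, v}) : Signature.{max u v, max u v} where
  F := FStar S
  G := GStar S
  arF := FStar.arity
  arG := GStar.arity
  ordF := FStar.ord
  ordG := GStar.ord

section Connectives

variable {S : Signature.{u, v}} {P : Type w}

/-- `f(φ₁, …, φₙ)` in the tense language, for `f ∈ F`. -/
def starF (f : S.F) (args : Fin (S.arF f) → Formula S.star P) : Formula S.star P :=
  .opF (S := S.star) (FStar.base f) args

/-- `g(φ₁, …, φₙ)` in the tense language, for `g ∈ G`. -/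
def starG (g : S.G) (args : Fin (S.arG g) → Formula S.star P) : Formula S.star P :=
  .opG (S := S.star) (GStar.base g) args

/-- `f♯ᵢ(φ₁, …, φₙ)` where `ε_f(i) = 1`. -/
def sharpOne (f : S.F) (i : Fin (S.arF f)) (hi : S.ordF f i = Sgn.one)
    (args : Fin (S.arF f) → Formula S.star P) : Formula S.star P :=
  .opG (S := S.star) (GStar.sharp f i hi) args

/-- `f♯ᵢ(φ₁, …, φₙ)` where `ε_f(i) = ∂`. -/
def sharpDel (f : S.F) (i : Fin (S.arF f)) (hi : S.ordF f i = Sgn.del)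
    (args : Fin (S.arF f) → Formula S.star P) : Formula S.star P :=
  .opF (S := S.star) (FStar.sharp f i hi) args

/-- `g♭ᵢ(φ₁, …, φₙ)` where `ε_g(i) = 1`. -/
def flatOne (g : S.G) (i : Fin (S.arG g)) (hi : S.ordG g i = Sgn.one)
    (args : Fin (S.arG g) → Formula S.star P) : Formula S.star P :=
  .opF (S := S.star) (FStar.flat g i hi) args

/-- `g♭ᵢ(φ₁, …, φₙ)` where `ε_g(i) = ∂`. -/
def flatDel (g : S.G) (i : Fin (S.arG g)) (hi : S.ordG g i = Sgn.del)
    (args : Fin (S.arG g) → Formula S.star P) : Formula S.star P :=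
  .opG (S := S.star) (GStar.flat g i hi) args

end Connectives

/-- The inclusion of the language of `S` into the tense language. -/
def Formula.toStar {S : Signature.{u, v}} {P : Type w} : Formula S P → Formula S.star P
  | .var p => .var p
  | .bot => .bot
  | .top => .top
  | .and φ ψ => .and φ.toStar ψ.toStar
  | .or φ ψ => .or φ.toStar ψ.toStar
  | .opF f args => starF f (fun i => (args i).toStar)
  | .opG g args => starG g (fun i => (args i).toStar)

def Sequent.toStar {S : Signature.{u, v}} {P : Type w} (s : Sequent S P) : Sequent S.star P :=
  ⟨s.lhs.toStar, s.rhs.toStar⟩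

open Function in
/-- The residuation rules of the tense logic. Each rule is invertible, hence is given by two
constructors: `…_down` infers the lower sequent from the upper one, `…_up` conversely. The tuple
`a` supplies the arguments in the coordinates other than `i`. -/
inductive ResiduationRule (S : Signature.{u, v}) (P : Type w) :
    Sequent S.star P → Sequent S.star P → Prop
  | fOne_down (f : S.F) (i : Fin (S.arF f)) (hi : S.ordF f i = Sgn.one)
      (a : Fin (S.arF f) → Formula S.star P) (φ ψ : Formula S.star P) :
      ResiduationRule S P ⟨starF f (update a i φ), ψ⟩ ⟨φ, sharpOne f i hi (update a i ψ)⟩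
  | fOne_up (f : S.F) (i : Fin (S.arF f)) (hi : S.ordF f i = Sgn.one)
      (a : Fin (S.arF f) → Formula S.star P) (φ ψ : Formula S.star P) :
      ResiduationRule S P ⟨φ, sharpOne f i hi (update a i ψ)⟩ ⟨starF f (update a i φ), ψ⟩
  | gOne_down (g : S.G) (i : Fin (S.arG g)) (hi : S.ordG g i = Sgn.one)
      (a : Fin (S.arG g) → Formula S.star P) (φ ψ : Formula S.star P) :
      ResiduationRule S P ⟨φ, starG g (update a i ψ)⟩ ⟨flatOne g i hi (update a i φ), ψ⟩
  | gOne_up (g : S.G) (i : Fin (S.arG g)) (hi : S.ordG g i = Sgn.one)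
      (a : Fin (S.arG g) → Formula S.star P) (φ ψ : Formula S.star P) :
      ResiduationRule S P ⟨flatOne g i hi (update a i φ), ψ⟩ ⟨φ, starG g (update a i ψ)⟩
  | fDel_down (f : S.F) (i : Fin (S.arF f)) (hi : S.ordF f i = Sgn.del)
      (a : Fin (S.arF f) → Formula S.star P) (φ ψ : Formula S.star P) :
      ResiduationRule S P ⟨starF f (update a i φ), ψ⟩ ⟨sharpDel f i hi (update a i ψ), φ⟩
  | fDel_up (f : S.F) (i : Fin (S.arF f)) (hi : S.ordF f i = Sgn.del)
      (a : Fin (S.arF f) → Formula S.star P) (φ ψ : Formula S.star P) :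
      ResiduationRule S P ⟨sharpDel f i hi (update a i ψ), φ⟩ ⟨starF f (update a i φ), ψ⟩
  | gDel_down (g : S.G) (i : Fin (S.arG g)) (hi : S.ordG g i = Sgn.del)
      (a : Fin (S.arG g) → Formula S.star P) (φ ψ : Formula S.star P) :
      ResiduationRule S P ⟨φ, starG g (update a i ψ)⟩ ⟨ψ, flatDel g i hi (update a i φ)⟩
  | gDel_up (g : S.G) (i : Fin (S.arG g)) (hi : S.ordG g i = Sgn.del)
      (a : Fin (S.arG g) → Formula S.star P) (φ ψ : Formula S.star P) :
      ResiduationRule S P ⟨ψ, flatDel g i hi (update a i φ)⟩ ⟨φ, starG g (update a i ψ)⟩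

/-- The basic tense logic associated with the signature `S`: the basic LE-logic of the tense
signature, closed in addition under the residuation rules. -/
def tenseLogic (S : Signature.{u, v}) (P : Type w) [DecidableEq P] : Set (Sequent S.star P) :=
  {s | Derivable S.star P (ResiduationRule S P) s}

end LELogic

/-! # Conservativity of the basic tense logic over the basic LE-logic -/

namespace LELogic

open Function

/-! ### Signs and signed lattice operations -/

/-! Passing from the basic logic to the tense logic is an induction on derivations
(`toStar_mem_tenseLogic`). The converse is semantic. A base sequent derivable in the tense logic is
shown to be valid in every bounded lattice whose connectives are interpreted by normal operators
(`Interpretation.valid_of_toStar_mem_tenseLogic`). Applied to the Lindenbaum algebra of the basic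
logic, under the valuation sending each letter to its class, this returns a derivation
(`Lindenbaum.derivable_of_valid`).

To obtain that validity, a lattice `A` with normal operators is embedded in its canonical extension,
the concept lattice of the relation "filter meets ideal". Each operator extends to an operation on
this complete lattice that has an adjoint in every coordinate (`IsNormalOp.isResiduated_extension`)
and agrees with the given operator on `A` (`IsNormalOp.extension_toCanonical`). The adjoints
interpret the added connectives. They are themselves residuated with exactly the prescribed
order-types (`IsResiduated.residual`), hence normal, so the whole tense logic is sound there. Since
the embedding reflects the order, inequalities between base formulas come back to `A`.

The signs treat the four cases (`F` or `G`, `1` or `∂`) at once: an operator has an output sign `t`,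
with `1` for `F` and `∂` for `G`, and its coordinate `i` behaves according to the product `t.mul (ε
i)`. -/

/-- Multiplication of signs, with `1` as unit. -/
def Sgn.mul : Sgn → Sgn → Sgn
  | .one, s => s
  | .del, s => s.opp

@[simp] theorem Sgn.opp_opp (s : Sgn) : s.opp.opp = s := by cases s <;> rfl

section Signed

variable {A : Type*}

/-- The order of `A` for the sign `1`, the reverse order for the sign `∂`. -/
def SLe [LE A] : Sgn → A → A → Prop
  | .one, x, y => x ≤ y
  | .del, x, y => y ≤ x

theorem sLe_opp [LE A] {s : Sgn} {x y : A} : SLe s.opp x y ↔ SLe s y x := by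
  cases s <;> rfl

theorem SLe.refl [Preorder A] (s : Sgn) (x : A) : SLe s x x := by
  cases s <;> exact le_refl x

theorem SLe.trans [Preorder A] {s : Sgn} {x y z : A} (h : SLe s x y) (h' : SLe s y z) :
    SLe s x z := by
  cases s
  · exact le_trans (α := A) h h'
  · exact le_trans (α := A) h' h

theorem SLe.antisymm [PartialOrder A] {s : Sgn} {x y : A} (h : SLe s x y) (h' : SLe s y x) :
    x = y := by
  cases s
  · exact le_antisymm (α := A) h h'
  · exact le_antisymm (α := A) h' h

/-- The greatest element with respect to `SLe s`. -/
def sTop [LE A] [BoundedOrder A] : Sgn → A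
  | .one => ⊤
  | .del => ⊥

/-- Binary meets with respect to `SLe s`. -/
def sInf₂ [Lattice A] : Sgn → A → A → A
  | .one, x, y => x ⊓ y
  | .del, x, y => x ⊔ y

theorem sLe_sTop [Lattice A] [BoundedOrder A] (s : Sgn) (x : A) : SLe s x (sTop s) := by
  cases s
  · exact le_top (α := A)
  · exact bot_le (α := A)

theorem sTop_opp_sLe [Lattice A] [BoundedOrder A] (s : Sgn) (x : A) :
    SLe s (sTop s.opp) x := by
  cases s
  · exact bot_le (α := A)
  · exact le_top (α := A)

theorem sLe_sInf₂ [Lattice A] {s : Sgn} {x y z : A} :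
    SLe s x (sInf₂ s y z) ↔ SLe s x y ∧ SLe s x z := by
  cases s
  · exact le_inf_iff (α := A)
  · exact sup_le_iff (α := A)

theorem sInf₂_opp_sLe [Lattice A] {s : Sgn} {x y z : A} :
    SLe s (sInf₂ s.opp x y) z ↔ SLe s x z ∧ SLe s y z := by
  cases s
  · exact sup_le_iff (α := A)
  · exact le_inf_iff (α := A)

end Signed

/-- A function of a tuple that respects a relation in each coordinate respects it jointly. -/
theorem rel_of_forall_update {α γ : Type*} {n : ℕ} {k : (Fin n → α) → γ} {R : γ → γ → Prop}
    {r : Fin n → α → α → Prop} (hrefl : ∀ x, R x x) (htrans : ∀ x y z, R x y → R y z → R x z)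
    (hk : ∀ a i x y, r i x y → R (k (update a i x)) (k (update a i y))) {a b : Fin n → α}
    (hab : ∀ i, r i (a i) (b i)) : R (k a) (k b) := by
  -- Here `s` is the set of coordinates already changed from `a` to `b`.
  suffices ∀ s : Finset (Fin n), R (k a) (k (s.piecewise b a)) by
    simpa using this Finset.univ
  intro s
  induction s using Finset.induction_on with
  | empty => simpa using hrefl (k a)
  | insert i s hi ih =>
    refine htrans _ _ _ ih ?_
    rw [Finset.piecewise_insert]
    -- Writing the old tuple as a trivial update makes the two tuples updates of the same tuple at
    -- `i`.
    conv in k (s.piecewise b a) => rw [← update_eq_self i (s.piecewise b a)]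
    refine hk _ i _ _ ?_
    rw [Finset.piecewise_eq_of_notMem _ _ _ hi]
    exact hab i

/-! ### Normal operators and algebras -/

/-- `h` is a normal operator of order-type `ε`: for the output sign `t = 1` it is finitely
join-preserving or meet-reversing in each coordinate, and dually for `t = ∂`. -/
structure IsNormalOp {A : Type*} [Lattice A] [BoundedOrder A] {n : ℕ} (t : Sgn)
    (ε : OrderType n) (h : (Fin n → A) → A) : Prop where
  mono (a : Fin n → A) (i : Fin n) (x y : A) (hxy : SLe (t.mul (ε i)) x y) :
    SLe t (h (update a i x)) (h (update a i y))
  bot (a : Fin n → A) (i : Fin n) :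
    SLe t (h (update a i (sTop (t.mul (ε i)).opp))) (sTop t.opp)
  sup (a : Fin n → A) (i : Fin n) (x y : A) :
    SLe t (h (update a i (sInf₂ (t.mul (ε i)).opp x y)))
      (sInf₂ t.opp (h (update a i x)) (h (update a i y)))

/-- Operations on a bounded lattice interpreting the connectives of `S` by normal operators. -/
structure Interpretation (S : Signature.{u, v}) (A : Type*) [Lattice A] [BoundedOrder A] where
  opF (f : S.F) : (Fin (S.arF f) → A) → A
  opG (g : S.G) : (Fin (S.arG g) → A) → A
  normalF (f : S.F) : IsNormalOp .one (S.ordF f) (opF f)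
  normalG (g : S.G) : IsNormalOp .del (S.ordG g) (opG g)

section Soundness

variable {S : Signature.{u, v}} {P : Type w} {A : Type*} [Lattice A] [BoundedOrder A]

/-- The value of a formula under a valuation of the proposition letters. -/
def Interpretation.eval (M : Interpretation S A) (e : P → A) : Formula S P → A
  | .var p => e p
  | .bot => ⊥
  | .top => ⊤
  | .and φ ψ => M.eval e φ ⊓ M.eval e ψ
  | .or φ ψ => M.eval e φ ⊔ M.eval e ψ
  | .opF f a => M.opF f (fun i => M.eval e (a i))
  | .opG g a => M.opG g (fun i => M.eval e (a i))

/-- A sequent is valid if it holds under all valuations. -/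
def Interpretation.Valid (M : Interpretation S A) (s : Sequent S P) : Prop :=
  ∀ e : P → A, M.eval e s.lhs ≤ M.eval e s.rhs

theorem Interpretation.eval_subst (M : Interpretation S A) (e : P → A) (σ : P → Formula S P)
    (φ : Formula S P) : M.eval e (φ.subst σ) = M.eval (fun p => M.eval e (σ p)) φ := by
  induction φ with
  | var p => rfl
  | bot => rfl
  | top => rfl
  | and φ ψ h₁ h₂ => simp only [Formula.subst, eval, h₁, h₂]
  | or φ ψ h₁ h₂ => simp only [Formula.subst, eval, h₁, h₂]
  | opF f a h => simp only [Formula.subst, eval, h]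
  | opG g a h => simp only [Formula.subst, eval, h]

theorem Interpretation.eval_update (M : Interpretation S A) (e : P → A) {n : ℕ}
    (a : Fin n → Formula S P) (i : Fin n) (φ : Formula S P) :
    (fun j => M.eval e (update a i φ j)) = update (fun j => M.eval e (a j)) i (M.eval e φ) :=
  funext fun j => apply_update (fun _ => M.eval e) a i φ j

theorem Interpretation.eval_atF (M : Interpretation S A) (e : P → A) (f : S.F)
    (a : Fin (S.arF f) → P) (i : Fin (S.arF f)) (φ : Formula S P) :
    M.eval e (.atF f a i φ) = M.opF f (update (fun j => e (a j)) i (M.eval e φ)) :=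
  congrArg (M.opF f) (M.eval_update e _ i φ)

theorem Interpretation.eval_atG (M : Interpretation S A) (e : P → A) (g : S.G)
    (a : Fin (S.arG g) → P) (i : Fin (S.arG g)) (φ : Formula S P) :
    M.eval e (.atG g a i φ) = M.opG g (update (fun j => e (a j)) i (M.eval e φ)) :=
  congrArg (M.opG g) (M.eval_update e _ i φ)

/-- Soundness. The invariant quantifies over all valuations because the substitution rule changes
the valuation; the extra rules accordingly only need to preserve validity. -/
theorem Interpretation.valid_of_derivable [DecidableEq P] (M : Interpretation S A)
    {R : Sequent S P → Sequent S P → Prop} (hR : ∀ s t, R s t → M.Valid s → M.Valid t)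
    {s : Sequent S P} (hs : Derivable S P R s) : M.Valid s := by
  induction hs with
  | refl p => exact fun e => le_rfl
  | botLe p => exact fun e => bot_le
  | leTop p => exact fun e => le_top
  | leOrLeft p q => exact fun e => le_sup_left
  | leOrRight p q => exact fun e => le_sup_right
  | andLeLeft p q => exact fun e => inf_le_left
  | andLeRight p q => exact fun e => inf_le_right
  | fBot f a i hi =>
    intro e
    -- Once the sign at `i` is known, the signed law unfolds to the axiom. The remaining connective
    -- cases work the same way.
    have := (M.normalF f).bot (fun j => e (a j)) i
    rw [hi] at this
    simpa only [eval_atF] using! this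
  | fTop f a i hi =>
    intro e
    have := (M.normalF f).bot (fun j => e (a j)) i
    rw [hi] at this
    simpa only [eval_atF] using! this
  | gTop g a i hi =>
    intro e
    have := (M.normalG g).bot (fun j => e (a j)) i
    rw [hi] at this
    simpa only [eval_atG] using! this
  | gBot g a i hi =>
    intro e
    have := (M.normalG g).bot (fun j => e (a j)) i
    rw [hi] at this
    simpa only [eval_atG] using! this
  | fOr f a i p q hi =>
    intro e
    have := (M.normalF f).sup (fun j => e (a j)) i (e p) (e q)
    rw [hi] at this
    simpa only [eval_atF, eval] using! this
  | fAnd f a i p q hi =>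
    intro e
    have := (M.normalF f).sup (fun j => e (a j)) i (e p) (e q)
    rw [hi] at this
    simpa only [eval_atF, eval] using! this
  | gAnd g a i p q hi =>
    intro e
    have := (M.normalG g).sup (fun j => e (a j)) i (e p) (e q)
    rw [hi] at this
    simpa only [eval_atG, eval] using! this
  | gOr g a i p q hi =>
    intro e
    have := (M.normalG g).sup (fun j => e (a j)) i (e p) (e q)
    rw [hi] at this
    simpa only [eval_atG, eval] using! this
  | cut φ χ ψ _ _ h₁ h₂ => exact fun e => (h₁ e).trans (h₂ e)
  | substitution φ ψ χ p _ h =>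
    intro e
    simp only [Formula.subst1, eval_subst]
    exact h _
  | leAnd χ φ ψ _ _ h₁ h₂ => exact fun e => le_inf (h₁ e) (h₂ e)
  | orLe φ ψ χ _ _ h₁ h₂ => exact fun e => sup_le (h₁ e) (h₂ e)
  | fMono f a i φ ψ hi _ h =>
    intro e
    have := (M.normalF f).mono (fun j => e (a j)) i (M.eval e φ) (M.eval e ψ)
    rw [hi] at this
    simpa only [eval_atF] using! this (h e)
  | fAnti f a i φ ψ hi _ h =>
    intro e
    have := (M.normalF f).mono (fun j => e (a j)) i (M.eval e ψ) (M.eval e φ)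
    rw [hi] at this
    simpa only [eval_atF] using! this (h e)
  | gMono g a i φ ψ hi _ h =>
    intro e
    have := (M.normalG g).mono (fun j => e (a j)) i (M.eval e ψ) (M.eval e φ)
    rw [hi] at this
    simpa only [eval_atG] using! this (h e)
  | gAnti g a i φ ψ hi _ h =>
    intro e
    have := (M.normalG g).mono (fun j => e (a j)) i (M.eval e φ) (M.eval e ψ)
    rw [hi] at this
    simpa only [eval_atG] using! this (h e)
  | extra s t hst _ h => exact hR s t hst h

end Soundness

/-! ### Residuated operators -/

section Residuation

variable {C : Type*} {n : ℕ} {t : Sgn} {ε : OrderType n} {h : (Fin n → C) → C}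

/-- `h` is residuated in each coordinate, the direction of the adjunction in the coordinate `i`
being given by the output sign `t` and by `ε i`. -/
def IsResiduated [LE C] (t : Sgn) (ε : OrderType n) (h : (Fin n → C) → C) : Prop :=
  ∀ (a : Fin n → C) (i : Fin n), ∃ r : C → C, ∀ x y,
    SLe t (h (update a i x)) y ↔ SLe (t.mul (ε i)) x (r y)

/-- Lower adjoints are monotone and preserve finite joins; the signs turn this into all the
variants. -/
theorem IsResiduated.isNormalOp [Lattice C] [BoundedOrder C] (hh : IsResiduated t ε h) :
    IsNormalOp t ε h where
  mono a i x y hxy := by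
    obtain ⟨r, hr⟩ := hh a i
    exact (hr _ _).2 (hxy.trans ((hr _ _).1 (SLe.refl _ _)))
  bot a i := by
    obtain ⟨r, hr⟩ := hh a i
    exact (hr _ _).2 (sTop_opp_sLe _ _)
  sup a i x y := by
    obtain ⟨r, hr⟩ := hh a i
    have key := sInf₂_opp_sLe.1 (SLe.refl t (sInf₂ t.opp (h (update a i x)) (h (update a i y))))
    exact (hr _ _).2 (sInf₂_opp_sLe.2 ⟨(hr _ _).1 key.1, (hr _ _).1 key.2⟩)

/-- The residual of `h` in the coordinate `i`. -/
noncomputable def residual [CompleteLattice C] (t : Sgn) (ε : OrderType n)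
    (h : (Fin n → C) → C) (i : Fin n) (a : Fin n → C) : C :=
  -- The entry `a i` is not an argument of `h` here: it is the bound on the value of `h`.
  match t.mul (ε i) with
  | .one => sSup {x | SLe t (h (update a i x)) (a i)}
  | .del => sInf {x | SLe t (h (update a i x)) (a i)}

/-- By the adjunction, the set in the definition of `residual` is the principal down-set, or up-set,
of the value of the adjoint, so its supremum, or infimum, is that value. -/
theorem IsResiduated.sLe_residual [CompleteLattice C] (hh : IsResiduated t ε h) (i : Fin n)
    (a : Fin n → C) (x y : C) :
    SLe t (h (update a i x)) y ↔ SLe (t.mul (ε i)) x (residual t ε h i (update a i y)) := by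
  obtain ⟨r, hr⟩ := hh a i
  suffices residual t ε h i (update a i y) = r y by rw [this, hr]
  simp only [residual, update_idem, update_self, hr]
  generalize t.mul (ε i) = s
  cases s
  · exact csSup_Iic (a := r y)
  · exact csInf_Ici (a := r y)

/-- In coordinate `i` the adjoint of the residual is `h` itself, with the order reversed. In a
coordinate `j ≠ i`, the inequality is moved back to one about `h` and then solved for the `j`-th
argument. The sign computations `hs` are what forces the form of `residualOrd`. -/
theorem IsResiduated.residual [CompleteLattice C] (hh : IsResiduated t ε h) (i : Fin n) :
    IsResiduated (t.mul (ε i)).opp (residualOrd ε i) (residual t ε h i) := by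
  intro a j
  rcases eq_or_ne j i with rfl | hj
  · refine ⟨fun x => h (update a j x), fun y x => ?_⟩
    have hs : ((t.mul (ε j)).opp.mul (residualOrd ε j j)) = t.opp := by
      simp only [residualOrd, if_pos]
      cases t <;> cases ε j <;> rfl
    rw [hs, sLe_opp, sLe_opp, hh.sLe_residual]
  · have hs : ((t.mul (ε i)).opp.mul (residualOrd ε i j)) = t.mul (ε j) := by
      simp only [residualOrd, if_neg hj]
      cases t <;> cases ε i <;> cases ε j <;> rfl
    -- The adjoint of `h` in coordinate `j` depends on `x`, which now occupies coordinate `i`; the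
    -- bound is the old entry `a i`.
    choose r hr using fun x : C => hh (update a i x) j
    refine ⟨fun x => r x (a i), fun z x => ?_⟩
    rw [hs, sLe_opp, ← hr, update_comm hj.symm, hh.sLe_residual, update_comm hj, update_eq_self]

/-- Residuated operations for `S` on a complete lattice interpret the tense signature. -/
noncomputable def residuatedInterpretation {S : Signature.{u, v}} [CompleteLattice C]
    (oF : ∀ f : S.F, (Fin (S.arF f) → C) → C) (oG : ∀ g : S.G, (Fin (S.arG g) → C) → C)
    (hF : ∀ f, IsResiduated .one (S.ordF f) (oF f))
    (hG : ∀ g, IsResiduated .del (S.ordG g) (oG g)) : Interpretation S.star C where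
  opF
    | .base f => oF f
    | .sharp f i _ => residual .one (S.ordF f) (oF f) i
    | .flat g i _ => residual .del (S.ordG g) (oG g) i
  opG
    | .base g => oG g
    | .sharp f i _ => residual .one (S.ordF f) (oF f) i
    | .flat g i _ => residual .del (S.ordG g) (oG g) i
  normalF
    | .base f => (hF f).isNormalOp
    | .sharp f i hi => by
      have := ((hF f).residual i).isNormalOp
      rwa [hi] at this
    | .flat g i hi => by
      have := ((hG g).residual i).isNormalOp
      rwa [hi] at this
  normalG
    | .base g => (hG g).isNormalOp
    | .sharp f i hi => by
      have := ((hF f).residual i).isNormalOp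
      rwa [hi] at this
    | .flat g i hi => by
      have := ((hG g).residual i).isNormalOp
      rwa [hi] at this

theorem residuatedInterpretation_valid {S : Signature.{u, v}} {P : Type w} [CompleteLattice C]
    (oF : ∀ f : S.F, (Fin (S.arF f) → C) → C) (oG : ∀ g : S.G, (Fin (S.arG g) → C) → C)
    (hF : ∀ f, IsResiduated .one (S.ordF f) (oF f))
    (hG : ∀ g, IsResiduated .del (S.ordG g) (oG g)) {s s' : Sequent S.star P}
    (hss' : ResiduationRule S P s s')
    (hs : (residuatedInterpretation oF oG hF hG).Valid s) :
    (residuatedInterpretation oF oG hF hG).Valid s' := by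
  set M := residuatedInterpretation oF oG hF hG with hM
  -- All residuation rules for `F` are the two directions of this equivalence, read at the two
  -- possible signs; `keyG` does the same for `G`.
  have keyF (e : P → C) (f : S.F) (i : Fin (S.arF f)) (a : Fin (S.arF f) → Formula S.star P)
      (φ ψ : Formula S.star P) :
      oF f (fun j => M.eval e (update a i φ j)) ≤ M.eval e ψ ↔
        SLe (S.ordF f i) (M.eval e φ)
          (residual .one (S.ordF f) (oF f) i (fun j => M.eval e (update a i ψ j))) := by
    rw [M.eval_update, M.eval_update]
    exact (hF f).sLe_residual i _ _ _
  have keyG (e : P → C) (g : S.G) (i : Fin (S.arG g)) (a : Fin (S.arG g) → Formula S.star P)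
      (φ ψ : Formula S.star P) :
      M.eval e φ ≤ oG g (fun j => M.eval e (update a i ψ j)) ↔
        SLe (S.ordG g i).opp (M.eval e ψ)
          (residual .del (S.ordG g) (oG g) i (fun j => M.eval e (update a i φ j))) := by
    rw [M.eval_update, M.eval_update]
    exact (hG g).sLe_residual i _ _ _
  intro e
  replace hs := hs e
  cases hss' with
  | fOne_down f i hi a φ ψ =>
    have := (keyF e f i a φ ψ).1 hs
    rwa [hi] at this
  | fOne_up f i hi a φ ψ =>
    refine (keyF e f i a φ ψ).2 ?_
    rwa [hi]
  | gOne_down g i hi a φ ψ =>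
    have := (keyG e g i a φ ψ).1 hs
    rwa [hi] at this
  | gOne_up g i hi a φ ψ =>
    refine (keyG e g i a φ ψ).2 ?_
    rwa [hi]
  | fDel_down f i hi a φ ψ =>
    have := (keyF e f i a φ ψ).1 hs
    rwa [hi] at this
  | fDel_up f i hi a φ ψ =>
    refine (keyF e f i a φ ψ).2 ?_
    rwa [hi]
  | gDel_down g i hi a φ ψ =>
    have := (keyG e g i a φ ψ).1 hs
    rwa [hi] at this
  | gDel_up g i hi a φ ψ =>
    refine (keyG e g i a φ ψ).2 ?_
    rwa [hi]

end Residuation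

/-! ### The canonical extension of a bounded lattice -/

section Canonical

variable {A : Type*} [Lattice A] [BoundedOrder A] {n : ℕ} {t : Sgn} {ε : OrderType n}
  {h : (Fin n → A) → A}

/-- `X` is a filter (for the sign `1`) or an ideal (for the sign `∂`); both may be improper. -/
structure IsPoint (s : Sgn) (X : Set A) : Prop where
  top_mem : sTop s ∈ X
  mem_of_sLe {x y : A} : x ∈ X → SLe s x y → y ∈ X
  inf_mem {x y : A} : x ∈ X → y ∈ X → sInf₂ s x y ∈ X

/-- The filters (for the sign `1`) or the ideals (for the sign `∂`) of `A`. -/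
def Point (A : Type*) [Lattice A] [BoundedOrder A] (s : Sgn) : Type _ :=
  {X : Set A // IsPoint s X}

theorem isPoint_principal (s : Sgn) (a : A) : IsPoint s {b | SLe s a b} where
  top_mem := sLe_sTop _ _
  mem_of_sLe h h' := SLe.trans h h'
  inf_mem h h' := sLe_sInf₂.2 ⟨h, h'⟩

/-- The filter or ideal generated by `a`. -/
def Point.principal (s : Sgn) (a : A) : Point A s := ⟨_, isPoint_principal s a⟩

/-- The canonical extension of `A`: the concepts of the relation "the filter `X` meets the ideal
`Y`". -/
abbrev CanonicalExtension (A : Type*) [Lattice A] [BoundedOrder A] : Type _ :=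
  Concept (Point A .one) (Point A .del) (fun X Y => (X.1 ∩ Y.1).Nonempty)

/-- The filters below `u` (for the sign `1`) or the ideals above `u` (for the sign `∂`). -/
def side : (s : Sgn) → CanonicalExtension A → Set (Point A s)
  | .one, u => u.extent
  | .del, u => u.intent

theorem side_subset_side {s : Sgn} {u u' : CanonicalExtension A} :
    side s u ⊆ side s u' ↔ SLe s u u' := by
  cases s
  · exact Concept.extent_subset_extent_iff
  · exact Concept.intent_subset_intent_iff

/-- A set of filters or of ideals that can be separated from the points outside it is a side of
some element of the canonical extension. -/
theorem exists_side_eq {s : Sgn} (T : Set (Point A s))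
    (hT : ∀ X ∉ T, ∃ Y : Set A, IsPoint s.opp Y ∧ ¬ (X.1 ∩ Y).Nonempty ∧
      ∀ X' ∈ T, (X'.1 ∩ Y).Nonempty) :
    ∃ u : CanonicalExtension A, side s u = T := by
  cases s
  -- The witness is generated by all opposite points that meet every member of `T`. The two signs
  -- differ only in the orientation of the relation.
  · refine ⟨.ofAttributes _ {Y | ∀ X ∈ T, (X.1 ∩ Y.1).Nonempty}, ?_⟩
    refine Set.Subset.antisymm (fun X hX => ?_) fun X hX Y hY => hY X hX
    by_contra hXT
    obtain ⟨Y, hY, hXY, hTY⟩ := hT X hXT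
    exact hXY (hX (b := ⟨Y, hY⟩) hTY)
  · refine ⟨.ofObjects _ {Y | ∀ X ∈ T, (X.1 ∩ Y.1).Nonempty}, ?_⟩
    refine Set.Subset.antisymm (fun X hX => ?_) fun X hX Y hY => ?_
    · by_contra hXT
      obtain ⟨Y, hY, hXY, hTY⟩ := hT X hXT
      exact hXY (Set.inter_comm Y X.1 ▸ hX (a := ⟨Y, hY⟩) hTY)
    · obtain ⟨z, hzX, hzY⟩ := hY X hX
      exact ⟨z, hzY, hzX⟩

/-- The principal ideal of `a` separates the filters containing `a` from the others. An ideal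
meeting all these filters meets the principal filter of `a`, so it contains `a`; thus one concept
has both descriptions. -/
theorem exists_side_eq_mem (a : A) : ∃ u : CanonicalExtension A, ∀ s, side s u = {X | a ∈ X.1} := by
  obtain ⟨u, hu⟩ := exists_side_eq (s := .one) {X : Point A .one | a ∈ X.1} fun X hX =>
    ⟨_, isPoint_principal _ a, fun ⟨b, hb, hb'⟩ => hX (X.2.mem_of_sLe hb hb'),
      fun X' hX' => ⟨a, hX', SLe.refl Sgn.one.opp a⟩⟩
  refine ⟨u, fun s => ?_⟩
  cases s
  · exact hu
  · have : u.extent = _ := hu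
    change u.intent = _
    rw [← u.upperPolar_extent, this]
    refine Set.Subset.antisymm (fun Y hY => ?_) fun Y hY X hX => ⟨a, hX, hY⟩
    obtain ⟨b, hb, hb'⟩ := hY (a := Point.principal .one a) (SLe.refl .one a)
    exact Y.2.mem_of_sLe hb' hb

/-- The embedding of `A` into its canonical extension. -/
noncomputable def toCanonical (a : A) : CanonicalExtension A := (exists_side_eq_mem a).choose

theorem mem_side_toCanonical {s : Sgn} {a : A} {X : Point A s} :
    X ∈ side s (toCanonical a) ↔ a ∈ X.1 := by
  rw [toCanonical, (exists_side_eq_mem a).choose_spec s]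
  rfl

/-- The order is reflected because the principal filter of `a` must contain `b`. -/
theorem toCanonical_le_iff {a b : A} : toCanonical a ≤ toCanonical b ↔ a ≤ b := by
  refine (side_subset_side (s := .one)).symm.trans ⟨fun hab => ?_, fun hab X hX => ?_⟩
  · exact mem_side_toCanonical.1 (hab (mem_side_toCanonical (X := Point.principal .one a) |>.2
      (SLe.refl .one a)))
  · exact mem_side_toCanonical.2 (X.2.mem_of_sLe (mem_side_toCanonical.1 hX) hab)

theorem CanonicalExtension.ext_side (s : Sgn) {u u' : CanonicalExtension A}
    (hu : ∀ X, X ∈ side s u ↔ X ∈ side s u') : u = u' :=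
  SLe.antisymm (side_subset_side.1 fun X => (hu X).1) (side_subset_side.1 fun X => (hu X).2)

theorem toCanonical_top : toCanonical (⊤ : A) = ⊤ :=
  CanonicalExtension.ext_side .one fun X =>
    ⟨fun _ => Set.mem_univ X, fun _ => mem_side_toCanonical.2 X.2.top_mem⟩

theorem toCanonical_bot : toCanonical (⊥ : A) = ⊥ :=
  CanonicalExtension.ext_side .del fun X =>
    ⟨fun _ => Set.mem_univ X, fun _ => mem_side_toCanonical.2 X.2.top_mem⟩

theorem mem_side_inf {u u' : CanonicalExtension A} {X : Point A .one} :
    X ∈ side .one (u ⊓ u') ↔ X ∈ side .one u ∧ X ∈ side .one u' := Iff.rfl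

theorem mem_side_sup {u u' : CanonicalExtension A} {X : Point A .del} :
    X ∈ side .del (u ⊔ u') ↔ X ∈ side .del u ∧ X ∈ side .del u' := Iff.rfl

/-- Meets are tested on filters, where they are intersections of extents; joins below are tested on
ideals. -/
theorem toCanonical_inf (a b : A) : toCanonical (a ⊓ b) = toCanonical a ⊓ toCanonical b := by
  refine CanonicalExtension.ext_side .one fun X => ?_
  simp only [mem_side_inf, mem_side_toCanonical]
  exact ⟨fun hX => ⟨X.2.mem_of_sLe hX (inf_le_left (α := A)),
    X.2.mem_of_sLe hX (inf_le_right (α := A))⟩, fun hX => X.2.inf_mem hX.1 hX.2⟩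

theorem toCanonical_sup (a b : A) : toCanonical (a ⊔ b) = toCanonical a ⊔ toCanonical b := by
  refine CanonicalExtension.ext_side .del fun X => ?_
  simp only [mem_side_sup, mem_side_toCanonical]
  exact ⟨fun hX => ⟨X.2.mem_of_sLe hX (le_sup_left (α := A)),
    X.2.mem_of_sLe hX (le_sup_right (α := A))⟩, fun hX => X.2.inf_mem hX.1 hX.2⟩

theorem IsNormalOp.mono_all (hh : IsNormalOp t ε h) {a b : Fin n → A}
    (hab : ∀ i, SLe (t.mul (ε i)) (a i) (b i)) : SLe t (h a) (h b) :=
  rel_of_forall_update (R := SLe t) (SLe.refl t) (fun _ _ _ => SLe.trans) hh.mono hab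

/-- The relation interpreting `h` on the filters and ideals of `A`. -/
def opRel (t : Sgn) (ε : OrderType n) (h : (Fin n → A) → A) (J : Point A t.opp)
    (X : ∀ i, Point A (t.mul (ε i))) : Prop :=
  ∃ a : Fin n → A, (∀ i, a i ∈ (X i).1) ∧ h a ∈ J.1

/-- If `J` fails at `X`, it is separated by the point generated by the values of `h` on tuples from
`X`. Only monotonicity of `h` is needed for this to be a point. -/
theorem IsNormalOp.exists_side_output (hh : IsNormalOp t ε h) (u : Fin n → CanonicalExtension A) :
    ∃ c : CanonicalExtension A, side t.opp c =
      {J | ∀ X : ∀ i, Point A (t.mul (ε i)), (∀ i, X i ∈ side _ (u i)) → opRel t ε h J X} := by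
  refine exists_side_eq _ fun J hJ => ?_
  simp only [Set.mem_ofPred_eq, not_forall] at hJ
  obtain ⟨X, hX, hJX⟩ := hJ
  refine ⟨{b | ∃ a : Fin n → A, (∀ i, a i ∈ (X i).1) ∧ SLe t (h a) b}, ?_, ?_, ?_⟩
  · rw [Sgn.opp_opp]
    refine ⟨⟨fun i => sTop _, fun i => (X i).2.top_mem, sLe_sTop _ _⟩, ?_, ?_⟩
    · rintro x y ⟨a, ha, hx⟩ hxy
      exact ⟨a, ha, hx.trans hxy⟩
    · rintro x y ⟨a, ha, hx⟩ ⟨b, hb, hy⟩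
      refine ⟨fun i => sInf₂ _ (a i) (b i), fun i => (X i).2.inf_mem (ha i) (hb i),
        sLe_sInf₂.2 ⟨?_, ?_⟩⟩
      · exact (hh.mono_all fun i => (sLe_sInf₂.1 (SLe.refl _ _)).1).trans hx
      · exact (hh.mono_all fun i => (sLe_sInf₂.1 (SLe.refl _ _)).2).trans hy
  · rintro ⟨b, hb, a, ha, hab⟩
    exact hJX ⟨a, ha, J.2.mem_of_sLe hb (sLe_opp.2 hab)⟩
  · intro J' hJ'
    obtain ⟨a, ha, haJ⟩ := hJ' X hX
    exact ⟨h a, haJ, a, ha, SLe.refl _ _⟩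

/-- This set is the side of the future adjoint at `y`. A point `Z` outside it fails for some `J` and
`X`, and is separated by the elements that `h` sends into `J` when its other arguments come from
`X`. Preservation of bottoms and joins in coordinate `i` makes these elements a point. -/
theorem IsNormalOp.exists_side_coordinate (hh : IsNormalOp t ε h)
    (u : Fin n → CanonicalExtension A) (i : Fin n) (y : CanonicalExtension A) :
    ∃ c : CanonicalExtension A, side (t.mul (ε i)) c =
      {Z | ∀ J ∈ side t.opp y, ∀ X : ∀ j, Point A (t.mul (ε j)),
        (∀ j ≠ i, X j ∈ side _ (u j)) → X i = Z → opRel t ε h J X} := by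
  refine exists_side_eq _ fun Z hZ => ?_
  simp only [Set.mem_ofPred_eq, not_forall] at hZ
  obtain ⟨J, hJ, X, hX, rfl, hJX⟩ := hZ
  refine ⟨{c | ∃ a : Fin n → A, (∀ j ≠ i, a j ∈ (X j).1) ∧ h (update a i c) ∈ J.1}, ?_, ?_, ?_⟩
  · refine ⟨⟨fun i => sTop _, fun j _ => (X j).2.top_mem, ?_⟩, ?_, ?_⟩
    · exact J.2.mem_of_sLe J.2.top_mem (sLe_opp.2 (hh.bot _ i))
    · rintro c d ⟨a, ha, hc⟩ hcd
      exact ⟨a, ha, J.2.mem_of_sLe hc (sLe_opp.2 (hh.mono a i _ _ (sLe_opp.1 hcd)))⟩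
    · rintro c d ⟨a, ha, hc⟩ ⟨b, hb, hd⟩
      refine ⟨fun j => sInf₂ _ (a j) (b j), fun j hj => (X j).2.inf_mem (ha j hj) (hb j hj), ?_⟩
      -- The two witnessing tuples are replaced by their signed meet, so that `c` and `d` share the
      -- same side arguments before `hh.sup` is applied.
      refine J.2.mem_of_sLe (J.2.inf_mem (J.2.mem_of_sLe hc (sLe_opp.2 (hh.mono_all ?_)))
        (J.2.mem_of_sLe hd (sLe_opp.2 (hh.mono_all ?_)))) (sLe_opp.2 (hh.sup _ i c d))
      · intro j
        rcases eq_or_ne j i with rfl | hj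
        · simpa only [update_self] using SLe.refl _ c
        · simpa only [update_of_ne hj] using (sLe_sInf₂.1 (SLe.refl _ _)).1
      · intro j
        rcases eq_or_ne j i with rfl | hj
        · simpa only [update_self] using SLe.refl _ d
        · simpa only [update_of_ne hj] using (sLe_sInf₂.1 (SLe.refl _ _)).2
  · rintro ⟨c, hc, a, ha, hac⟩
    refine hJX ⟨update a i c, fun j => ?_, hac⟩
    rcases eq_or_ne j i with rfl | hj
    · rwa [update_self]
    · rw [update_of_ne hj]
      exact ha j hj
  · intro Z hZ
    obtain ⟨a, ha, haJ⟩ := hZ J hJ (update X i Z)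
      (fun j hj => by rw [update_of_ne hj]; exact hX j hj) (update_self i Z X)
    refine ⟨a i, by simpa only [update_self] using ha i, a, fun j hj => ?_, ?_⟩
    · simpa only [update_of_ne hj] using ha j
    · rwa [update_eq_self]

/-- The extension of a normal operator to the canonical extension. -/
noncomputable def IsNormalOp.extension (hh : IsNormalOp t ε h)
    (u : Fin n → CanonicalExtension A) : CanonicalExtension A :=
  (hh.exists_side_output u).choose

theorem IsNormalOp.side_extension (hh : IsNormalOp t ε h) (u : Fin n → CanonicalExtension A) :
    side t.opp (hh.extension u) =
      {J | ∀ X : ∀ i, Point A (t.mul (ε i)), (∀ i, X i ∈ side _ (u i)) → opRel t ε h J X} :=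
  (hh.exists_side_output u).choose_spec

/-- Both inequalities unfold to one condition: `opRel` holds for all `J` in the side of `y` and all
`X` drawn from the sides of the arguments. It does not single out the coordinate that is solved for.
-/
theorem IsNormalOp.isResiduated_extension (hh : IsNormalOp t ε h) :
    IsResiduated t ε hh.extension := by
  intro u i
  choose r hr using hh.exists_side_coordinate u i
  refine ⟨r, fun x y => ?_⟩
  rw [← sLe_opp, ← side_subset_side, ← side_subset_side, hr, hh.side_extension]
  constructor
  · rintro H Z hZ J hJ X hX rfl
    refine H hJ X fun j => ?_
    rcases eq_or_ne j i with rfl | hj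
    · rwa [update_self]
    · rw [update_of_ne hj]
      exact hX j hj
  · intro H J hJ X hX
    refine H (by simpa only [update_self] using hX i) J hJ X (fun j hj => ?_) rfl
    simpa only [update_of_ne hj] using hX j

/-- Testing on the principal points of the `a i` yields a tuple `b` on the far side of `a` with `h
b` in `J`; monotonicity then puts `h a` in `J`. Conversely `a` itself is a witness. -/
theorem IsNormalOp.extension_toCanonical (hh : IsNormalOp t ε h) (a : Fin n → A) :
    hh.extension (fun i => toCanonical (a i)) = toCanonical (h a) := by
  refine CanonicalExtension.ext_side t.opp fun J => ?_
  rw [hh.side_extension, mem_side_toCanonical]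
  constructor
  · intro H
    obtain ⟨b, hb, hbJ⟩ := H (fun i => Point.principal _ (a i))
      fun i => mem_side_toCanonical.2 (SLe.refl _ _)
    exact J.2.mem_of_sLe hbJ (sLe_opp.2 (hh.mono_all hb))
  · exact fun H X hX => ⟨a, fun i => mem_side_toCanonical.1 (hX i), H⟩

/-- The interpretation of the tense signature in the canonical extension. -/
noncomputable def Interpretation.canonical {S : Signature.{u, v}} (M : Interpretation S A) :
    Interpretation S.star (CanonicalExtension A) :=
  residuatedInterpretation (fun f => (M.normalF f).extension) (fun g => (M.normalG g).extension)
    (fun f => (M.normalF f).isResiduated_extension) (fun g => (M.normalG g).isResiduated_extension)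

theorem Interpretation.eval_canonical_toStar {S : Signature.{u, v}} {P : Type w}
    (M : Interpretation S A) (e : P → A) (φ : Formula S P) :
    M.canonical.eval (fun p => toCanonical (e p)) φ.toStar = toCanonical (M.eval e φ) := by
  induction φ with
  | var p => rfl
  | bot => exact toCanonical_bot.symm
  | top => exact toCanonical_top.symm
  | and φ ψ h₁ h₂ => simp only [Formula.toStar, eval, h₁, h₂, toCanonical_inf]
  | or φ ψ h₁ h₂ => simp only [Formula.toStar, eval, h₁, h₂, toCanonical_sup]
  | opF f a h =>
    exact (congrArg (M.normalF f).extension (funext h)).trans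
      ((M.normalF f).extension_toCanonical _)
  | opG g a h =>
    exact (congrArg (M.normalG g).extension (funext h)).trans
      ((M.normalG g).extension_toCanonical _)

/-- Sequents of the base language that are derivable in the tense logic are valid in all algebras
for the base signature. -/
theorem Interpretation.valid_of_toStar_mem_tenseLogic {S : Signature.{u, v}} {P : Type w}
    [DecidableEq P] (M : Interpretation S A) {s : Sequent S P}
    (hs : s.toStar ∈ tenseLogic S P) : M.Valid s := by
  intro e
  have := M.canonical.valid_of_derivable (fun _ _ => residuatedInterpretation_valid _ _ _ _) hs
    (fun p => toCanonical (e p))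
  simpa only [Sequent.toStar, eval_canonical_toStar, toCanonical_le_iff] using this

end Canonical

/-! ### Substitution and the Lindenbaum algebra -/

section Syntactic

variable {S : Signature.{u, v}} {P : Type w}

/-- The proposition letters occurring in a formula. -/
def Formula.letters : Formula S P → Set P
  | .var p => {p}
  | .bot => ∅
  | .top => ∅
  | .and φ ψ => φ.letters ∪ ψ.letters
  | .or φ ψ => φ.letters ∪ ψ.letters
  | .opF _ a => ⋃ i, (a i).letters
  | .opG _ a => ⋃ i, (a i).letters

theorem Formula.finite_letters (φ : Formula S P) : φ.letters.Finite := by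
  induction φ with
  | var p => exact Set.finite_singleton p
  | bot => exact Set.finite_empty
  | top => exact Set.finite_empty
  | and φ ψ h₁ h₂ => exact h₁.union h₂
  | or φ ψ h₁ h₂ => exact h₁.union h₂
  | opF f a h => exact Set.finite_iUnion h
  | opG g a h => exact Set.finite_iUnion h

theorem Formula.subst_congr {σ τ : P → Formula S P} {φ : Formula S P}
    (h : ∀ p ∈ φ.letters, σ p = τ p) : φ.subst σ = φ.subst τ := by
  induction φ with
  | var p => exact h p rfl
  | bot => rfl
  | top => rfl
  | and φ ψ h₁ h₂ =>
    exact congrArg₂ Formula.and (h₁ fun p hp => h p (.inl hp)) (h₂ fun p hp => h p (.inr hp))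
  | or φ ψ h₁ h₂ =>
    exact congrArg₂ Formula.or (h₁ fun p hp => h p (.inl hp)) (h₂ fun p hp => h p (.inr hp))
  | opF f a ih =>
    exact congrArg _ (funext fun i => ih i fun p hp => h p (Set.mem_iUnion_of_mem i hp))
  | opG g a ih =>
    exact congrArg _ (funext fun i => ih i fun p hp => h p (Set.mem_iUnion_of_mem i hp))

theorem Formula.subst_var (φ : Formula S P) : φ.subst Formula.var = φ := by
  induction φ with
  | var p => rfl
  | bot => rfl
  | top => rfl
  | and φ ψ h₁ h₂ => exact congrArg₂ Formula.and h₁ h₂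
  | or φ ψ h₁ h₂ => exact congrArg₂ Formula.or h₁ h₂
  | opF f a h => exact congrArg _ (funext h)
  | opG g a h => exact congrArg _ (funext h)

theorem Formula.subst_eq_self {σ : P → Formula S P} {φ : Formula S P}
    (h : ∀ p ∈ φ.letters, σ p = .var p) : φ.subst σ = φ :=
  (subst_congr h).trans φ.subst_var

theorem Formula.subst_subst (σ τ : P → Formula S P) (φ : Formula S P) :
    (φ.subst σ).subst τ = φ.subst (fun p => (σ p).subst τ) := by
  induction φ with
  | var p => rfl
  | bot => rfl
  | top => rfl
  | and φ ψ h₁ h₂ => exact congrArg₂ Formula.and h₁ h₂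
  | or φ ψ h₁ h₂ => exact congrArg₂ Formula.or h₁ h₂
  | opF f a h => exact congrArg _ (funext h)
  | opG g a h => exact congrArg _ (funext h)

theorem Formula.subst_update (σ : P → Formula S P) {n : ℕ} (a : Fin n → P) (i : Fin n)
    (φ : Formula S P) :
    (fun j => (update (fun j => Formula.var (S := S) (a j)) i φ j).subst σ) =
      update (fun j => σ (a j)) i (φ.subst σ) :=
  funext fun j => apply_update (fun _ => Formula.subst σ) _ i φ j

/-- Given finitely many formulas to be avoided and a tuple of formulas, there are letters outside
the avoided formulas and a substitution that sends these letters to the tuple and fixes the avoided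
formulas. -/
theorem exists_fresh_substitution [Infinite P] {n : ℕ} (b : Fin n → Formula S P)
    (φ ψ : Formula S P) :
    ∃ (a : Fin n → P) (σ : P → Formula S P), (fun j => σ (a j)) = b ∧ φ.subst σ = φ ∧
      ψ.subst σ = ψ := by
  have hfin := φ.finite_letters.union ψ.finite_letters
  have := hfin.infinite_compl.to_subtype
  let ι := Infinite.natEmbedding (↥(φ.letters ∪ ψ.letters)ᶜ)
  let a : Fin n → P := fun j => ι j
  have ha : Injective a := fun i j hij => Fin.ext (ι.injective (Subtype.ext hij))
  have hout (x : P) (hx : x ∈ φ.letters ∪ ψ.letters) : extend a b .var x = .var x :=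
    extend_apply' _ _ _ fun ⟨j, hj⟩ => (ι j).2 (by rwa [← hj] at hx)
  exact ⟨a, extend a b .var, funext fun j => ha.extend_apply _ _ j,
    Formula.subst_eq_self fun p hp => hout p (.inl hp),
    Formula.subst_eq_self fun p hp => hout p (.inr hp)⟩

theorem exists_substitution_pair [Infinite P] (φ ψ : Formula S P) :
    ∃ (p q : P) (σ : P → Formula S P), σ p = φ ∧ σ q = ψ := by
  -- Nothing has to be avoided, so `⊥` serves as a dummy.
  obtain ⟨a, σ, h, -⟩ := exists_fresh_substitution ![φ, ψ] .bot .bot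
  exact ⟨a 0, a 1, σ, congrFun h 0, congrFun h 1⟩

theorem exists_substitution_cons_cons [Infinite P] {n : ℕ} (b : Fin n → Formula S P) (φ ψ : Formula S P) :
    ∃ (a : Fin n → P) (p q : P) (σ : P → Formula S P), (fun j => σ (a j)) = b ∧ σ p = φ ∧
      σ q = ψ := by
  obtain ⟨a, σ, h, -⟩ := exists_fresh_substitution (Fin.cons φ (Fin.cons ψ b)) .bot .bot
  exact ⟨fun j => a j.succ.succ, a 0, a 1, σ, funext fun j => congrFun h j.succ.succ,
    congrFun h 0, congrFun h 1⟩

variable [DecidableEq P]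

/-- Performing single substitutions one after another would act again on formulas already inserted.
Hence `p` is first renamed to a fresh `q`, then the rest of `σ` is applied by induction, and `σ p`
replaces `q` last. -/
theorem Derivable.subst_finite [Infinite P] {R : Sequent S P → Sequent S P → Prop} (T : Finset P) :
    ∀ {φ ψ : Formula S P} {σ : P → Formula S P}, (∀ p ∉ T, σ p = .var p) →
      Derivable S P R ⟨φ, ψ⟩ → Derivable S P R ⟨φ.subst σ, ψ.subst σ⟩ := by
  induction T using Finset.induction_on with
  | empty =>
    intro φ ψ σ hσ h
    rwa [Formula.subst_eq_self fun p _ => hσ p (Finset.notMem_empty p),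
      Formula.subst_eq_self fun p _ => hσ p (Finset.notMem_empty p)]
  | insert p T hp ih =>
    intro φ ψ σ hσ h
    obtain ⟨q, hq⟩ := (((φ.finite_letters.union ψ.finite_letters).union
      ((insert p T).finite_toSet.biUnion fun x _ => (σ x).finite_letters)).union
      (insert p T).finite_toSet).exists_notMem
    simp only [Set.mem_union, not_or, Set.mem_iUnion, not_exists] at hq
    obtain ⟨⟨⟨hqφ, hqψ⟩, hqσ⟩, hqT⟩ := hq
    have hqT' : q ∉ insert p T := hqT
    have hqp : q ≠ p := fun e => hqT' (e ▸ Finset.mem_insert_self _ _)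
    have hqT'' : q ∉ T := fun e => hqT' (Finset.mem_insert_of_mem e)
    have key (χ : Formula S P) (hχ : q ∉ χ.letters) :
        ((χ.subst1 (.var q) p).subst (update σ p (.var p))).subst1 (σ p) q = χ.subst σ := by
      simp only [Formula.subst1, Formula.subst_subst]
      refine Formula.subst_congr fun x hx => ?_
      have hxq : x ≠ q := fun e => hχ (e ▸ hx)
      rcases eq_or_ne x p with rfl | hxp
      · rw [update_self]
        simp only [Formula.subst]
        rw [update_of_ne hqp, hσ q hqT']
        exact update_self _ _ _
      · rw [update_of_ne hxp]
        simp only [Formula.subst]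
        rw [update_of_ne hxp]
        refine Formula.subst_eq_self fun y hy => update_of_ne (fun e => ?_) _ _
        subst e
        by_cases hxT : x ∈ insert p T
        · exact hqσ x hxT hy
        · rw [hσ x hxT] at hy
          exact hxq (Set.mem_singleton_iff.1 hy).symm
    rw [← key φ hqφ, ← key ψ hqψ]
    refine .substitution _ _ _ _ (ih (fun x hx => ?_) (.substitution _ _ _ _ h))
    rcases eq_or_ne x p with rfl | hxp
    · exact update_self _ _ _
    · rw [update_of_ne hxp]
      exact hσ x fun e => (Finset.mem_insert.1 e).elim hxp hx

/-- Derivability is closed under simultaneous substitutions. -/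
theorem Derivable.subst [Infinite P] {R : Sequent S P → Sequent S P → Prop} {φ ψ : Formula S P}
    (σ : P → Formula S P) (h : Derivable S P R ⟨φ, ψ⟩) :
    Derivable S P R ⟨φ.subst σ, ψ.subst σ⟩ := by
  classical
  have hfin := φ.finite_letters.union ψ.finite_letters
  have := h.subst_finite (σ := fun p => if p ∈ hfin.toFinset then σ p else .var p) hfin.toFinset
    fun p hp => if_neg hp
  rwa [Formula.subst_congr (τ := σ) fun p hp => if_pos (hfin.mem_toFinset.2 (.inl hp)),
    Formula.subst_congr (τ := σ) fun p hp => if_pos (hfin.mem_toFinset.2 (.inr hp))] at this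

/-- Derivability of a sequent, as a relation on formulas. -/
def Entails (φ ψ : Formula S P) : Prop := Derivable S P (fun _ _ => False) ⟨φ, ψ⟩

namespace Entails

variable {φ ψ χ : Formula S P}

theorem trans (h : Entails φ χ) (h' : Entails χ ψ) : Entails φ ψ := Derivable.cut _ _ _ h h'

variable [Infinite P]

theorem refl (φ : Formula S P) : Entails φ φ := by
  obtain ⟨p⟩ : Nonempty P := inferInstance
  -- The axiom is stated for letters only; a constant substitution gives it for every formula.
  exact (Derivable.refl p).subst fun _ => φ

theorem bot_le (φ : Formula S P) : Entails .bot φ := by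
  obtain ⟨p⟩ : Nonempty P := inferInstance
  exact (Derivable.botLe p).subst fun _ => φ

theorem le_top (φ : Formula S P) : Entails φ .top := by
  obtain ⟨p⟩ : Nonempty P := inferInstance
  exact (Derivable.leTop p).subst fun _ => φ

theorem le_or_left (φ ψ : Formula S P) : Entails φ (.or φ ψ) := by
  obtain ⟨p, q, σ, rfl, rfl⟩ := exists_substitution_pair φ ψ
  exact (Derivable.leOrLeft p q).subst σ

theorem le_or_right (φ ψ : Formula S P) : Entails ψ (.or φ ψ) := by
  obtain ⟨p, q, σ, rfl, rfl⟩ := exists_substitution_pair φ ψ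
  exact (Derivable.leOrRight p q).subst σ

theorem and_le_left (φ ψ : Formula S P) : Entails (.and φ ψ) φ := by
  obtain ⟨p, q, σ, rfl, rfl⟩ := exists_substitution_pair φ ψ
  exact (Derivable.andLeLeft p q).subst σ

theorem and_le_right (φ ψ : Formula S P) : Entails (.and φ ψ) ψ := by
  obtain ⟨p, q, σ, rfl, rfl⟩ := exists_substitution_pair φ ψ
  exact (Derivable.andLeRight p q).subst σ

end Entails

variable [Infinite P]

/-- The formulas over the letters `P`, preordered by derivability. -/
def FormulaPreorder (S : Signature.{u, v}) (P : Type w) : Type _ := Formula S P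

instance : Preorder (FormulaPreorder S P) where
  le φ ψ := Entails (S := S) (P := P) φ ψ
  le_refl := Entails.refl
  le_trans _ _ _ := Entails.trans

variable (S P) in
/-- The Lindenbaum algebra of the basic logic. -/
abbrev Lindenbaum : Type _ := Antisymmetrization (FormulaPreorder S P) (· ≤ ·)

/-- The class of a formula. -/
def Lindenbaum.mk (φ : Formula S P) : Lindenbaum S P :=
  toAntisymmetrization (α := FormulaPreorder S P) (· ≤ ·) φ

theorem Lindenbaum.mk_le_mk {φ ψ : Formula S P} : mk φ ≤ mk ψ ↔ Entails φ ψ := Iff.rfl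

theorem Lindenbaum.mk_surjective : Surjective (mk : Formula S P → Lindenbaum S P) :=
  Quotient.mk_surjective

theorem Lindenbaum.mk_eq_mk {φ ψ : Formula S P} :
    mk φ = mk ψ ↔ Entails φ ψ ∧ Entails ψ φ :=
  le_antisymm_iff

/-- A chosen representative. -/
noncomputable def Lindenbaum.rep (x : Lindenbaum S P) : Formula S P := surjInv mk_surjective x

theorem Lindenbaum.mk_rep (x : Lindenbaum S P) : mk x.rep = x := surjInv_eq mk_surjective x

noncomputable instance : Lattice (Lindenbaum S P) where
  inf x y := .mk (.and x.rep y.rep)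
  sup x y := .mk (.or x.rep y.rep)
  le_sup_left x y := x.mk_rep.symm.trans_le (Entails.le_or_left _ _)
  le_sup_right x y := y.mk_rep.symm.trans_le (Entails.le_or_right _ _)
  sup_le x y z hx hy := by
    rw [← x.mk_rep, ← z.mk_rep] at hx
    rw [← y.mk_rep, ← z.mk_rep] at hy
    exact LE.le.trans_eq (b := Lindenbaum.mk z.rep) (Derivable.orLe _ _ _ hx hy) z.mk_rep
  inf_le_left x y := LE.le.trans_eq (Entails.and_le_left _ _) x.mk_rep
  inf_le_right x y := LE.le.trans_eq (Entails.and_le_right _ _) y.mk_rep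
  le_inf x y z hy hz := by
    rw [← x.mk_rep, ← y.mk_rep] at hy
    rw [← x.mk_rep, ← z.mk_rep] at hz
    exact x.mk_rep.symm.trans_le (Derivable.leAnd _ _ _ hy hz)

noncomputable instance : BoundedOrder (Lindenbaum S P) where
  top := .mk .top
  bot := .mk .bot
  le_top x := x.mk_rep.symm.trans_le (Entails.le_top _)
  bot_le x := LE.le.trans_eq (Entails.bot_le _) x.mk_rep

/-- The meet was defined through chosen representatives; its universal property removes the choice.
-/
theorem Lindenbaum.mk_and (φ ψ : Formula S P) : mk (.and φ ψ) = mk φ ⊓ mk ψ :=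
  le_antisymm (le_inf (Entails.and_le_left φ ψ) (Entails.and_le_right φ ψ))
    (Derivable.leAnd _ _ _ (mk_le_mk.1 inf_le_left) (mk_le_mk.1 inf_le_right))

theorem Lindenbaum.mk_or (φ ψ : Formula S P) : mk (.or φ ψ) = mk φ ⊔ mk ψ :=
  le_antisymm (Derivable.orLe _ _ _ (mk_le_mk.1 le_sup_left) (mk_le_mk.1 le_sup_right))
    (sup_le (Entails.le_or_left φ ψ) (Entails.le_or_right φ ψ))

end Syntactic

/-! ### The Lindenbaum algebra as an algebra for the signature -/

section LindenbaumOperations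

variable {S : Signature.{u, v}} {P : Type w} [DecidableEq P] [Infinite P]

namespace Entails

section F

variable {f : S.F} (b : Fin (S.arF f) → Formula S P) {i : Fin (S.arF f)} {φ ψ : Formula S P}

/-- The rule only allows letters in the side places. They are taken fresh for `φ` and `ψ`, so that
substituting `b` for them afterwards leaves `φ` and `ψ` unchanged. -/
theorem opF_mono (hi : S.ordF f i = .one) (h : Entails φ ψ) :
    Entails (.opF f (update b i φ)) (.opF f (update b i ψ)) := by
  obtain ⟨a, σ, rfl, hφ, hψ⟩ := exists_fresh_substitution b φ ψ
  have := (Derivable.fMono (R := fun _ _ => False) f a i φ ψ hi h).subst σ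
  simpa only [Entails, Formula.atF, Formula.subst, Formula.subst_update, hφ, hψ] using this

theorem opF_anti (hi : S.ordF f i = .del) (h : Entails φ ψ) :
    Entails (.opF f (update b i ψ)) (.opF f (update b i φ)) := by
  obtain ⟨a, σ, rfl, hφ, hψ⟩ := exists_fresh_substitution b φ ψ
  have := (Derivable.fAnti (R := fun _ _ => False) f a i φ ψ hi h).subst σ
  simpa only [Entails, Formula.atF, Formula.subst, Formula.subst_update, hφ, hψ] using this

theorem opF_bot (hi : S.ordF f i = .one) : Entails (.opF f (update b i .bot)) .bot := by
  obtain ⟨a, σ, rfl, -⟩ := exists_fresh_substitution b .bot .bot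
  have := (Derivable.fBot (R := fun _ _ => False) f a i hi).subst σ
  simpa only [Entails, Formula.atF, Formula.subst, Formula.subst_update] using this

theorem opF_top (hi : S.ordF f i = .del) : Entails (.opF f (update b i .top)) .bot := by
  obtain ⟨a, σ, rfl, -⟩ := exists_fresh_substitution b .bot .bot
  have := (Derivable.fTop (R := fun _ _ => False) f a i hi).subst σ
  simpa only [Entails, Formula.atF, Formula.subst, Formula.subst_update] using this

variable (φ ψ)

theorem opF_or (hi : S.ordF f i = .one) : Entails (.opF f (update b i (.or φ ψ)))
    (.or (.opF f (update b i φ)) (.opF f (update b i ψ))) := by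
  obtain ⟨a, p, q, σ, rfl, rfl, rfl⟩ := exists_substitution_cons_cons b φ ψ
  have := (Derivable.fOr (R := fun _ _ => False) f a i p q hi).subst σ
  simpa only [Entails, Formula.atF, Formula.subst, Formula.subst_update] using this

theorem opF_and (hi : S.ordF f i = .del) : Entails (.opF f (update b i (.and φ ψ)))
    (.or (.opF f (update b i φ)) (.opF f (update b i ψ))) := by
  obtain ⟨a, p, q, σ, rfl, rfl, rfl⟩ := exists_substitution_cons_cons b φ ψ
  have := (Derivable.fAnd (R := fun _ _ => False) f a i p q hi).subst σ
  simpa only [Entails, Formula.atF, Formula.subst, Formula.subst_update] using this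

end F

section G

variable {g : S.G} (b : Fin (S.arG g) → Formula S P) {i : Fin (S.arG g)} {φ ψ : Formula S P}

theorem opG_mono (hi : S.ordG g i = .one) (h : Entails φ ψ) :
    Entails (.opG g (update b i φ)) (.opG g (update b i ψ)) := by
  obtain ⟨a, σ, rfl, hφ, hψ⟩ := exists_fresh_substitution b φ ψ
  have := (Derivable.gMono (R := fun _ _ => False) g a i φ ψ hi h).subst σ
  simpa only [Entails, Formula.atG, Formula.subst, Formula.subst_update, hφ, hψ] using this

theorem opG_anti (hi : S.ordG g i = .del) (h : Entails φ ψ) :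
    Entails (.opG g (update b i ψ)) (.opG g (update b i φ)) := by
  obtain ⟨a, σ, rfl, hφ, hψ⟩ := exists_fresh_substitution b φ ψ
  have := (Derivable.gAnti (R := fun _ _ => False) g a i φ ψ hi h).subst σ
  simpa only [Entails, Formula.atG, Formula.subst, Formula.subst_update, hφ, hψ] using this

theorem opG_top (hi : S.ordG g i = .one) : Entails .top (.opG g (update b i .top)) := by
  obtain ⟨a, σ, rfl, -⟩ := exists_fresh_substitution b .bot .bot
  have := (Derivable.gTop (R := fun _ _ => False) g a i hi).subst σ
  simpa only [Entails, Formula.atG, Formula.subst, Formula.subst_update] using this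

theorem opG_bot (hi : S.ordG g i = .del) : Entails .top (.opG g (update b i .bot)) := by
  obtain ⟨a, σ, rfl, -⟩ := exists_fresh_substitution b .bot .bot
  have := (Derivable.gBot (R := fun _ _ => False) g a i hi).subst σ
  simpa only [Entails, Formula.atG, Formula.subst, Formula.subst_update] using this

variable (φ ψ)

theorem opG_and (hi : S.ordG g i = .one) : Entails
    (.and (.opG g (update b i φ)) (.opG g (update b i ψ))) (.opG g (update b i (.and φ ψ))) := by
  obtain ⟨a, p, q, σ, rfl, rfl, rfl⟩ := exists_substitution_cons_cons b φ ψ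
  have := (Derivable.gAnd (R := fun _ _ => False) g a i p q hi).subst σ
  simpa only [Entails, Formula.atG, Formula.subst, Formula.subst_update] using this

theorem opG_or (hi : S.ordG g i = .del) : Entails
    (.and (.opG g (update b i φ)) (.opG g (update b i ψ))) (.opG g (update b i (.or φ ψ))) := by
  obtain ⟨a, p, q, σ, rfl, rfl, rfl⟩ := exists_substitution_cons_cons b φ ψ
  have := (Derivable.gOr (R := fun _ _ => False) g a i p q hi).subst σ
  simpa only [Entails, Formula.atG, Formula.subst, Formula.subst_update] using this

end G

end Entails

namespace Lindenbaum

/-- The monotonicity rules act on one coordinate, so equivalent arguments are exchanged one at a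
time. -/
theorem mk_opF_congr (f : S.F) {b c : Fin (S.arF f) → Formula S P}
    (hbc : ∀ i, mk (b i) = mk (c i)) : mk (.opF f b) = mk (.opF f c) := by
  refine rel_of_forall_update (k := fun b => mk (.opF f b)) (R := Eq)
    (r := fun _ φ ψ => mk φ = mk ψ) (fun _ => rfl) (fun _ _ _ => Eq.trans) ?_ hbc
  intro a i φ ψ h
  rw [mk_eq_mk] at h ⊢
  cases hi : S.ordF f i
  · exact ⟨.opF_mono a hi h.1, .opF_mono a hi h.2⟩
  · exact ⟨.opF_anti a hi h.2, .opF_anti a hi h.1⟩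

theorem mk_opG_congr (g : S.G) {b c : Fin (S.arG g) → Formula S P}
    (hbc : ∀ i, mk (b i) = mk (c i)) : mk (.opG g b) = mk (.opG g c) := by
  refine rel_of_forall_update (k := fun b => mk (.opG g b)) (R := Eq)
    (r := fun _ φ ψ => mk φ = mk ψ) (fun _ => rfl) (fun _ _ _ => Eq.trans) ?_ hbc
  intro a i φ ψ h
  rw [mk_eq_mk] at h ⊢
  cases hi : S.ordG g i
  · exact ⟨.opG_mono a hi h.1, .opG_mono a hi h.2⟩
  · exact ⟨.opG_anti a hi h.2, .opG_anti a hi h.1⟩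

/-- The operation interpreting `f ∈ F`. -/
noncomputable def opF (f : S.F) (a : Fin (S.arF f) → Lindenbaum S P) : Lindenbaum S P :=
  mk (.opF f fun i => (a i).rep)

/-- The operation interpreting `g ∈ G`. -/
noncomputable def opG (g : S.G) (a : Fin (S.arG g) → Lindenbaum S P) : Lindenbaum S P :=
  mk (.opG g fun i => (a i).rep)

theorem opF_mk (f : S.F) (b : Fin (S.arF f) → Formula S P) :
    opF f (fun i => mk (b i)) = mk (.opF f b) :=
  mk_opF_congr f fun _ => mk_rep _

theorem opG_mk (g : S.G) (b : Fin (S.arG g) → Formula S P) :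
    opG g (fun i => mk (b i)) = mk (.opG g b) :=
  mk_opG_congr g fun _ => mk_rep _

theorem mk_update {n : ℕ} (b : Fin n → Formula S P) (i : Fin n) (φ : Formula S P) :
    update (fun j => mk (b j)) i (mk φ) = fun j => mk (update b i φ j) :=
  (funext fun j => apply_update (fun _ => mk) b i φ j).symm

theorem exists_rep {n : ℕ} (a : Fin n → Lindenbaum S P) :
    ∃ b : Fin n → Formula S P, (fun i => mk (b i)) = a :=
  ⟨fun i => (a i).rep, funext fun i => (a i).mk_rep⟩

theorem isNormalOp_opF (f : S.F) :
    IsNormalOp .one (S.ordF f) (opF f : (Fin (S.arF f) → Lindenbaum S P) → _) where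
  mono a i x y hxy := by
    obtain ⟨b, rfl⟩ := exists_rep a
    obtain ⟨φ, rfl⟩ := mk_surjective x
    obtain ⟨ψ, rfl⟩ := mk_surjective y
    rw [mk_update, mk_update, opF_mk, opF_mk]
    cases hi : S.ordF f i <;> rw [hi] at hxy
    · exact Entails.opF_mono b hi hxy
    · exact Entails.opF_anti b hi hxy
  bot a i := by
    obtain ⟨b, rfl⟩ := exists_rep a
    cases hi : S.ordF f i
    · change opF f (update _ i (mk .bot)) ≤ mk .bot
      rw [mk_update, opF_mk]
      exact Entails.opF_bot b hi
    · change opF f (update _ i (mk .top)) ≤ mk .bot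
      rw [mk_update, opF_mk]
      exact Entails.opF_top b hi
  sup a i x y := by
    obtain ⟨b, rfl⟩ := exists_rep a
    obtain ⟨φ, rfl⟩ := mk_surjective x
    obtain ⟨ψ, rfl⟩ := mk_surjective y
    cases hi : S.ordF f i
    · change opF f (update _ i (mk φ ⊔ mk ψ)) ≤ opF f (update _ i _) ⊔ opF f (update _ i _)
      rw [← mk_or, mk_update, mk_update, mk_update, opF_mk, opF_mk, opF_mk, ← mk_or]
      exact Entails.opF_or b φ ψ hi
    · change opF f (update _ i (mk φ ⊓ mk ψ)) ≤ opF f (update _ i _) ⊔ opF f (update _ i _)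
      rw [← mk_and, mk_update, mk_update, mk_update, opF_mk, opF_mk, opF_mk, ← mk_or]
      exact Entails.opF_and b φ ψ hi

theorem isNormalOp_opG (g : S.G) :
    IsNormalOp .del (S.ordG g) (opG g : (Fin (S.arG g) → Lindenbaum S P) → _) where
  mono a i x y hxy := by
    obtain ⟨b, rfl⟩ := exists_rep a
    obtain ⟨φ, rfl⟩ := mk_surjective x
    obtain ⟨ψ, rfl⟩ := mk_surjective y
    rw [mk_update, mk_update, opG_mk, opG_mk]
    cases hi : S.ordG g i <;> rw [hi] at hxy
    · exact Entails.opG_mono b hi hxy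
    · exact Entails.opG_anti b hi hxy
  bot a i := by
    obtain ⟨b, rfl⟩ := exists_rep a
    cases hi : S.ordG g i
    · change mk .top ≤ opG g (update _ i (mk .top))
      rw [mk_update, opG_mk]
      exact Entails.opG_top b hi
    · change mk .top ≤ opG g (update _ i (mk .bot))
      rw [mk_update, opG_mk]
      exact Entails.opG_bot b hi
  sup a i x y := by
    obtain ⟨b, rfl⟩ := exists_rep a
    obtain ⟨φ, rfl⟩ := mk_surjective x
    obtain ⟨ψ, rfl⟩ := mk_surjective y
    cases hi : S.ordG g i
    · change opG g (update _ i _) ⊓ opG g (update _ i _) ≤ opG g (update _ i (mk φ ⊓ mk ψ))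
      rw [← mk_and, mk_update, mk_update, mk_update, opG_mk, opG_mk, opG_mk, ← mk_and]
      exact Entails.opG_and b φ ψ hi
    · change opG g (update _ i _) ⊓ opG g (update _ i _) ≤ opG g (update _ i (mk φ ⊔ mk ψ))
      rw [← mk_or, mk_update, mk_update, mk_update, opG_mk, opG_mk, opG_mk, ← mk_and]
      exact Entails.opG_or b φ ψ hi

variable (S P) in
/-- The Lindenbaum algebra interprets the signature. -/
noncomputable def interpretation : Interpretation S (Lindenbaum S P) where
  opF := opF
  opG := opG
  normalF := isNormalOp_opF
  normalG := isNormalOp_opG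

/-- The truth lemma: validity at this one valuation is already derivability. -/
theorem eval_mk_var (φ : Formula S P) :
    (interpretation S P).eval (fun p => mk (.var p)) φ = mk φ := by
  induction φ with
  | var p => rfl
  | bot => rfl
  | top => rfl
  | and φ ψ h₁ h₂ => rw [Interpretation.eval, h₁, h₂, mk_and]
  | or φ ψ h₁ h₂ => rw [Interpretation.eval, h₁, h₂, mk_or]
  | opF f a h => exact (congrArg (opF f) (funext h)).trans (opF_mk f a)
  | opG g a h => exact (congrArg (opG g) (funext h)).trans (opG_mk g a)

theorem derivable_of_valid {s : Sequent S P} (hs : (interpretation S P).Valid s) :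
    s ∈ basicLogic S P := by
  have := hs fun p => mk (.var p)
  rw [eval_mk_var, eval_mk_var] at this
  exact this

end Lindenbaum

end LindenbaumOperations

/-! ### The inclusion of the basic logic in the tense logic -/

section Inclusion

variable {S : Signature.{u, v}} {P : Type w}

theorem Formula.toStar_subst (σ : P → Formula S P) (φ : Formula S P) :
    (φ.subst σ).toStar = φ.toStar.subst (fun p => (σ p).toStar) := by
  induction φ with
  | var p => rfl
  | bot => rfl
  | top => rfl
  | and φ ψ h₁ h₂ => exact congrArg₂ Formula.and h₁ h₂
  | or φ ψ h₁ h₂ => exact congrArg₂ Formula.or h₁ h₂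
  | opF f a h => exact congrArg (starF f) (funext h)
  | opG g a h => exact congrArg (starG g) (funext h)

theorem Formula.toStar_subst1 [DecidableEq P] (φ χ : Formula S P) (p : P) :
    (φ.subst1 χ p).toStar = φ.toStar.subst1 χ.toStar p := by
  rw [Formula.subst1, Formula.toStar_subst]
  exact congrArg (fun σ => φ.toStar.subst σ)
    (funext fun q => apply_update (fun _ => Formula.toStar) _ p χ q)

theorem Formula.toStar_atF (f : S.F) (a : Fin (S.arF f) → P) (i : Fin (S.arF f))
    (φ : Formula S P) :
    (Formula.atF f a i φ).toStar = Formula.atF (S := S.star) (FStar.base f) a i φ.toStar :=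
  congrArg (starF f) (funext fun j => apply_update (fun _ => Formula.toStar) _ i φ j)

theorem Formula.toStar_atG (g : S.G) (a : Fin (S.arG g) → P) (i : Fin (S.arG g))
    (φ : Formula S P) :
    (Formula.atG g a i φ).toStar = Formula.atG (S := S.star) (GStar.base g) a i φ.toStar :=
  congrArg (starG g) (funext fun j => apply_update (fun _ => Formula.toStar) _ i φ j)

/-- Base connectives keep their arity and order-type in the tense signature, so each axiom or rule
translates to an instance of the same one. -/
theorem toStar_mem_tenseLogic [DecidableEq P] {s : Sequent S P} (hs : s ∈ basicLogic S P) :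
    s.toStar ∈ tenseLogic S P := by
  change Derivable S.star P _ _
  change Derivable S P _ _ at hs
  induction hs with
  | refl p => exact .refl p
  | botLe p => exact .botLe p
  | leTop p => exact .leTop p
  | leOrLeft p q => exact .leOrLeft p q
  | leOrRight p q => exact .leOrRight p q
  | andLeLeft p q => exact .andLeLeft p q
  | andLeRight p q => exact .andLeRight p q
  | fBot f a i hi =>
    simp only [Sequent.toStar, Formula.toStar_atF]
    exact .fBot (S := S.star) (FStar.base f) a i hi
  | fTop f a i hi =>
    simp only [Sequent.toStar, Formula.toStar_atF]
    exact .fTop (S := S.star) (FStar.base f) a i hi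
  | gTop g a i hi =>
    simp only [Sequent.toStar, Formula.toStar_atG]
    exact .gTop (S := S.star) (GStar.base g) a i hi
  | gBot g a i hi =>
    simp only [Sequent.toStar, Formula.toStar_atG]
    exact .gBot (S := S.star) (GStar.base g) a i hi
  | fOr f a i p q hi =>
    simp only [Sequent.toStar, Formula.toStar, Formula.toStar_atF]
    exact .fOr (S := S.star) (FStar.base f) a i p q hi
  | fAnd f a i p q hi =>
    simp only [Sequent.toStar, Formula.toStar, Formula.toStar_atF]
    exact .fAnd (S := S.star) (FStar.base f) a i p q hi
  | gAnd g a i p q hi =>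
    simp only [Sequent.toStar, Formula.toStar, Formula.toStar_atG]
    exact .gAnd (S := S.star) (GStar.base g) a i p q hi
  | gOr g a i p q hi =>
    simp only [Sequent.toStar, Formula.toStar, Formula.toStar_atG]
    exact .gOr (S := S.star) (GStar.base g) a i p q hi
  | cut φ χ ψ _ _ h₁ h₂ => exact .cut _ _ _ h₁ h₂
  | substitution φ ψ χ p _ h =>
    simp only [Sequent.toStar, Formula.toStar_subst1]
    exact .substitution _ _ _ p h
  | leAnd χ φ ψ _ _ h₁ h₂ => exact .leAnd _ _ _ h₁ h₂
  | orLe φ ψ χ _ _ h₁ h₂ => exact .orLe _ _ _ h₁ h₂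
  | fMono f a i φ ψ hi _ h =>
    simp only [Sequent.toStar, Formula.toStar_atF]
    exact .fMono (S := S.star) (FStar.base f) a i _ _ hi h
  | fAnti f a i φ ψ hi _ h =>
    simp only [Sequent.toStar, Formula.toStar_atF]
    exact .fAnti (S := S.star) (FStar.base f) a i _ _ hi h
  | gMono g a i φ ψ hi _ h =>
    simp only [Sequent.toStar, Formula.toStar_atG]
    exact .gMono (S := S.star) (GStar.base g) a i _ _ hi h
  | gAnti g a i φ ψ hi _ h =>
    simp only [Sequent.toStar, Formula.toStar_atG]
    exact .gAnti (S := S.star) (GStar.base g) a i _ _ hi h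
  | extra s t hst _ _ => exact hst.elim

end Inclusion

end LELogic

/-- The basic tense logic is a conservative extension of the basic LE-logic, for every LE-signature
`S` and every denumerable set `P` of proposition letters. -/
theorem mainTheorem11 (S : LELogic.Signature.{u, v}) (P : Type w) [DecidableEq P] [Countable P]
    [Infinite P] (s : LELogic.Sequent S P) :
    s ∈ LELogic.basicLogic S P ↔ s.toStar ∈ LELogic.tenseLogic S P :=
  ⟨LELogic.toStar_mem_tenseLogic, fun hs => LELogic.Lindenbaum.derivable_of_valid
    ((LELogic.Lindenbaum.interpretation S P).valid_of_toStar_mem_tenseLogic hs)⟩
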